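/- Let $\varphi:\mathbb R\to\mathbb R$ be an Orlicz $N$-function, i.e. continuous, even, convex, increasing on $(0,\infty)$, with $\varphi(0)=0$, $\varphi(x)/x\to0$ as $x\to0$ and $\varphi(x)/x\to\infty$ as $x\to\infty$; let $\varphi^{(-1)}$ be the inverse of its restriction to $[0,\infty)$ and assume $\varphi^{(-1)}(1)=1$. For a real random variable $\xi$ put $$\|\xi\|_{\tau_{\tilde\varphi}}=\sup_{p\ge1}\frac{(\mathbb E|\xi|^p)^{1/p}}{\varphi^{(-1)}(p)}\in[0,\infty].$$ **Corollary (linear regression with unbounded data).** Let $H$ be a real Hilbert space, $L\ge0$, let $\ell:\mathbb R\to\mathbb R$ be $1$-Lipschitz, and let $$\mathcal G=\{(x,y)\mapsto g(x,y)=\ell(\langle w,x\rangle-y)\;:\;w\in H,\ \|w\|\le L\}.$$ Let $(X_1,Y_1),\dots,(X_n,Y_n)$ be i.i.d. random pairs with values in $H\times\mathbb R$ (the $X_i$ strongly measurable), with size measured by $\|\|X_1\|\|_{\tau_{\tilde\varphi}}$ and $\|Y_1\|_{\tau_{\tilde\varphi}}$. If these two norms are finite, then $g(X_1,Y_1)$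 is integrable for every $g\in\mathcal G$. Moreover, if $\delta>0$ and $n\ge\ln(1/\delta)\ge1$, then with probability at least $1-\delta$ $$\sup_{g\in\mathcal G}\Big(\frac1n\sum_{i=1}^n g(X_i,Y_i)-\mathbb E\,g(X_1,Y_1)\Big)\le\frac{12}{\sqrt n}\Big(L\,\|\|X_1\|\|_{\tau_{\tilde\varphi}}+\|Y_1\|_{\tau_{\tilde\varphi}}\Big)\Big(1+e\sqrt{\ln(1/\delta)}\Big),$$ where the right-hand side is read in $[0,\infty]$ with $0\cdot\infty=0$, so that the inequality has content exactly when the right-hand side is finite. (No mean-zero or exponential-moment condition on the data is needed; in particular the statement covers $\varphi$-sub-Gaussian pairs.) -/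

import Mathlib

open MeasureTheory ProbabilityTheory Filter Topology
open scoped ENNReal

noncomputable section

/-- Orlicz N-functions: continuous, even, convex functions on `ℝ`, increasing on `(0, ∞)`, with
`φ 0 = 0`, `φ x / x → 0` as `x → 0` and `φ x / x → ∞` as `x → ∞`. -/
structure IsOrliczNFunction (φ : ℝ → ℝ) : Prop where
  continuous : Continuous φ
  even : ∀ x, φ (-x) = φ x
  convexOn : ConvexOn ℝ Set.univ φ
  monotoneOn : MonotoneOn φ (Set.Ioi 0)
  map_zero : φ 0 = 0
  tendsto_zero : Tendsto (fun x => φ x / x) (𝓝[≠] 0) (𝓝 0)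
  tendsto_atTop : Tendsto (fun x => φ x / x) atTop atTop

/-- The inverse function `φ⁽⁻¹⁾` of (the restriction to `[0, ∞)` of) an even function `φ`.
For an Orlicz N-function and `p > 0` it is the unique `x ≥ 0` with `φ x = p`. -/
def orliczInv (φ : ℝ → ℝ) : ℝ → ℝ :=
  Function.invFunOn φ (Set.Ici 0)

/-- The norm `‖ξ‖ = sup_{p ≥ 1} ‖ξ‖_p / φ⁽⁻¹⁾(p)` of a real random variable, in `[0, ∞]`. -/
def momentNorm {Ω : Type*} [MeasurableSpace Ω] (φ : ℝ → ℝ) (ξ : Ω → ℝ) (μ : Measure Ω) : ℝ≥0∞ :=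
  ⨆ (p : ℝ) (_ : 1 ≤ p), eLpNorm ξ (ENNReal.ofReal p) μ / ENNReal.ofReal (orliczInv φ p)

/-- The class of functions `(x, y) ↦ ℓ (⟪w, x⟫ - y)` with `‖w‖ ≤ L`. -/
def linearLossClass (H : Type*) [NormedAddCommGroup H] [InnerProductSpace ℝ H]
    (ℓ : ℝ → ℝ) (L : ℝ) : Set (H × ℝ → ℝ) :=
  {g | ∃ w : H, ‖w‖ ≤ L ∧ g = fun z => ℓ (inner ℝ w z.1 - z.2)}

/-- The uniform deviation `sup_{g ∈ 𝒢} ((1/n) ∑ᵢ g (Zᵢ) - E g (Z₁))` of a sample with values in `S`,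
as a supremum in `[-∞, ∞]`. The sample is indexed from `0`. -/
def uniformDeviation {Ω S : Type*} [MeasurableSpace Ω] {n : ℕ} [NeZero n]
    (𝒢 : Set (S → ℝ)) (Z : Fin n → Ω → S) (μ : Measure Ω) (ω : Ω) : EReal :=
  ⨆ g ∈ 𝒢, (((1 / (n : ℝ)) * ∑ i, g (Z i ω) - ∫ ω', g (Z 0 ω') ∂μ : ℝ) : EReal)

end

/-! The proof bounds an exponential moment of the whole supremum and applies Markov's inequality
once, so neither a separate bound on the expectation nor a concentration inequality for unbounded
functions is needed. Symmetrization (`card_mul_lintegral_exp_sup'_le`) replaces the centred process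
by a Rademacher process at twice the scale. Contraction (`sum_exp_sup'_contraction`) removes the
loss without a further constant. What remains is linear in the data and is at most a multiple of `‖∑
εᵢ xᵢ‖ + |∑ εᵢ yᵢ|`. Convexity of `exp` separates the two terms, and the parallelogram law bounds
the sign average of `cosh ‖∑ εᵢ xᵢ‖` by `∏ cosh ‖xᵢ‖`, as for real numbers. Independence turns the
mean of this product into a power of a one-variable mean. Convexity of `φ` and the normalization
give `φ⁽⁻¹⁾(p) ≤ p` for `p ≥ 1`, so the `2k`-th moments are at most `(2ka)^(2k)`; with `m^m / m! ≤
e^m` the power series of `cosh` is dominated by a geometric series, and only small scales are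
needed. This works for finitely many weights. Almost sure separability of the range, continuity in
the weight and monotone limits extend it to the ball. -/

/-! ### Two-point convexity inequalities -/

/-- Two-point majorization: a convex function sums to more at the outer pair `p, q` than at a pair
`x, y` with a smaller sum that stays below the larger of `p` and `q`. -/
theorem ConvexOn.add_le_add_of_add_eq {s : Set ℝ} {f : ℝ → ℝ} (hf : ConvexOn ℝ s f)
    {x y p q : ℝ} (hp : p ∈ s) (hq : q ∈ s) (hx : x ≤ p) (hy : y ≤ p) (h : x + y = p + q) :
    f x + f y ≤ f p + f q := by
  rcases eq_or_lt_of_le (show q ≤ p by linarith) with hqp | hqp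
  · have hxp : x = p := by linarith
    have hyq : y = q := by linarith
    rw [hxp, hyq]
  · have hd : 0 < p - q := sub_pos.2 hqp
    set a := (x - q) / (p - q) with ha
    have ha0 : 0 ≤ a := div_nonneg (by linarith) hd.le
    have ha1 : a ≤ 1 := (div_le_one hd).2 (by linarith)
    have hax : a * (p - q) = x - q := div_mul_cancel₀ _ hd.ne'
    have h1 := hf.2 hp hq ha0 (sub_nonneg.2 ha1) (by ring)
    have h2 := hf.2 hp hq (sub_nonneg.2 ha1) ha0 (by ring)
    simp only [smul_eq_mul] at h1 h2
    rw [show a * p + (1 - a) * q = x by linarith] at h1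
    rw [show (1 - a) * p + a * q = y by linarith] at h2
    linarith

/-- Lowering the smaller outer point until the sums agree reduces this to majorization; monotonicity
of `exp` pays for the lowering. -/
theorem Real.exp_add_exp_le_of_le_max {x y p q : ℝ} (hx : x ≤ max p q) (hy : y ≤ max p q)
    (h : x + y ≤ p + q) : Real.exp x + Real.exp y ≤ Real.exp p + Real.exp q := by
  wlog hpq : q ≤ p generalizing p q
  · rw [add_comm (Real.exp p)]
    exact this (by rwa [max_comm]) (by rwa [max_comm]) (by linarith) (by linarith)
  rw [max_eq_left hpq] at hx hy
  have h1 := convexOn_exp.add_le_add_of_add_eq (x := x) (y := y) (p := p) (q := x + y - p)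
    (Set.mem_univ _) (Set.mem_univ _) hx hy (by ring)
  have h2 : Real.exp (x + y - p) ≤ Real.exp q := Real.exp_le_exp.2 (by linarith)
  linarith

theorem pow_add_pow_le_of_add_eq {x y p q : ℝ} (hq : 0 ≤ q) (hp : 0 ≤ p) (hx : x ≤ p)
    (hy : y ≤ p) (h : x + y = p + q) (k : ℕ) : x ^ k + y ^ k ≤ p ^ k + q ^ k :=
  (convexOn_pow k).add_le_add_of_add_eq (Set.mem_Ici.2 hp) (Set.mem_Ici.2 hq) hx hy h

/-- This is the contraction step for a single sign. `habs` keeps both left exponents below the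
larger right one, and `hdiff` bounds their sum, which is what majorization for `exp` needs. -/
theorem exp_sup'_add_exp_sup'_le {W : Type*} (T : Finset W) (hT : T.Nonempty) (a b c : W → ℝ)
    (habs : ∀ v, |c v| ≤ |b v|) (hdiff : ∀ v w, |c v - c w| ≤ |b v - b w|) :
    Real.exp (T.sup' hT fun v => a v + c v) + Real.exp (T.sup' hT fun v => a v - c v) ≤
      Real.exp (T.sup' hT fun v => a v + b v) + Real.exp (T.sup' hT fun v => a v - b v) := by
  obtain ⟨v, hv, hv'⟩ := T.exists_mem_eq_sup' hT fun v => a v + c v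
  obtain ⟨w, hw, hw'⟩ := T.exists_mem_eq_sup' hT fun v => a v - c v
  rw [hv', hw']
  have hp : ∀ u ∈ T, a u + b u ≤ T.sup' hT fun v => a v + b v := fun u hu =>
    T.le_sup' (fun v => a v + b v) hu
  have hm : ∀ u ∈ T, a u - b u ≤ T.sup' hT fun v => a v - b v := fun u hu =>
    T.le_sup' (fun v => a v - b v) hu
  have hmax : ∀ u ∈ T, a u + |c u| ≤
      max (T.sup' hT fun v => a v + b v) (T.sup' hT fun v => a v - b v) := by
    intro u hu
    have h1 := habs u
    rcases abs_cases (b u) with ⟨h, -⟩ | ⟨h, -⟩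
    · exact le_max_of_le_left (by linarith [hp u hu])
    · exact le_max_of_le_right (by linarith [hm u hu])
  refine Real.exp_add_exp_le_of_le_max ?_ ?_ ?_
  · linarith [hmax v hv, le_abs_self (c v)]
  · linarith [hmax w hw, neg_abs_le (c w)]
  -- The maximizers `v, w` on the left are tested in the two suprema on the right, in the order
  -- given by the sign of `b v - b w`.
  · have h1 := (le_abs_self _).trans (hdiff v w)
    rcases abs_cases (b v - b w) with ⟨h, -⟩ | ⟨h, -⟩
    · linarith [hp v hv, hm w hw]
    · linarith [hp w hw, hm v hv]

/-! ### Contraction for Rademacher suprema -/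

section Contraction

variable {W : Type*} {ι : Type*} [DecidableEq ι]

/-- The sign vector `ε` with its `j`-th sign reversed. -/
def flipSign (j : ι) (ε : ι → ℤˣ) : ι → ℤˣ :=
  Function.update ε j (-ε j)

theorem flipSign_apply_self (j : ι) (ε : ι → ℤˣ) : flipSign j ε j = -ε j :=
  Function.update_self ..

theorem flipSign_apply_ne {i j : ι} (h : i ≠ j) (ε : ι → ℤˣ) : flipSign j ε i = ε i :=
  Function.update_of_ne h ..

theorem flipSign_involutive (j : ι) : Function.Involutive (flipSign j) := fun ε => by
  simp [flipSign]

/-- Reversing one sign permutes the sign vectors, so a comparison of sums may be checked on pairs;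
this plays the role of conditioning on the other signs. -/
theorem sum_le_sum_of_flipSign [Fintype ι] (j : ι) (F G : (ι → ℤˣ) → ℝ)
    (h : ∀ ε, F ε + F (flipSign j ε) ≤ G ε + G (flipSign j ε)) : ∑ ε, F ε ≤ ∑ ε, G ε := by
  have hsum : ∀ K : (ι → ℤˣ) → ℝ, ∑ ε, K (flipSign j ε) = ∑ ε, K ε :=
    Equiv.sum_comp (flipSign_involutive j).toPerm
  have := Finset.sum_le_sum fun ε (_ : ε ∈ Finset.univ) => h ε
  rw [Finset.sum_add_distrib, Finset.sum_add_distrib, hsum F, hsum G] at this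
  linarith

/-- The contraction principle for exponential moments of Rademacher suprema. -/
theorem sum_exp_sup'_contraction [Fintype ι] (T : Finset W) (hT : T.Nonempty) (h k : W → ι → ℝ)
    (habs : ∀ v i, |h v i| ≤ |k v i|) (hdiff : ∀ v w i, |h v i - h w i| ≤ |k v i - k w i|) :
    ∑ ε : ι → ℤˣ, Real.exp (T.sup' hT fun v => ∑ i, ((ε i : ℤ) : ℝ) * h v i) ≤
      ∑ ε : ι → ℤˣ, Real.exp (T.sup' hT fun v => ∑ i, ((ε i : ℤ) : ℝ) * k v i) := by
  -- The functions `h` are replaced by `k` one index at a time. For a fixed index `j`, the two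
  -- members of a flipped pair are a common part `a` plus and minus the `j`-th term.
  have key : ∀ s : Finset ι,
      ∑ ε : ι → ℤˣ, Real.exp (T.sup' hT fun v => ∑ i, ((ε i : ℤ) : ℝ) * h v i) ≤
      ∑ ε : ι → ℤˣ, Real.exp (T.sup' hT fun v =>
        ∑ i, ((ε i : ℤ) : ℝ) * if i ∈ s then k v i else h v i) := by
    intro s
    induction s using Finset.induction_on with
    | empty => simp
    | insert j s hj ih =>
      refine ih.trans (sum_le_sum_of_flipSign j _ _ fun ε => ?_)
      set a : W → ℝ := fun v =>
        ∑ i ∈ Finset.univ.erase j, ((ε i : ℤ) : ℝ) * if i ∈ s then k v i else h v i with ha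
      have e1 : ∀ v, ∑ i, ((ε i : ℤ) : ℝ) * (if i ∈ s then k v i else h v i) =
          a v + ((ε j : ℤ) : ℝ) * h v j := by
        intro v
        rw [← Finset.sum_erase_add _ _ (Finset.mem_univ j), if_neg hj]
      have e2 : ∀ v, ∑ i, ((flipSign j ε i : ℤ) : ℝ) *
          (if i ∈ s then k v i else h v i) = a v - ((ε j : ℤ) : ℝ) * h v j := by
        intro v
        rw [← Finset.sum_erase_add _ _ (Finset.mem_univ j), if_neg hj, flipSign_apply_self, ha]
        rw [Finset.sum_congr rfl fun i hi => by rw [flipSign_apply_ne (Finset.ne_of_mem_erase hi)]]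
        push_cast
        ring
      have hins : ∀ v, ∀ i ∈ Finset.univ.erase j,
          (if i ∈ insert j s then k v i else h v i) = if i ∈ s then k v i else h v i := by
        intro v i hi
        simp [Finset.ne_of_mem_erase hi]
      have e3 : ∀ v, ∑ i, ((ε i : ℤ) : ℝ) * (if i ∈ insert j s then k v i else h v i) =
          a v + ((ε j : ℤ) : ℝ) * k v j := by
        intro v
        rw [← Finset.sum_erase_add _ _ (Finset.mem_univ j), if_pos (Finset.mem_insert_self j s), ha]
        rw [Finset.sum_congr rfl fun i hi => by
          rw [hins v i hi]]
      have e4 : ∀ v, ∑ i, ((flipSign j ε i : ℤ) : ℝ) *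
          (if i ∈ insert j s then k v i else h v i) = a v - ((ε j : ℤ) : ℝ) * k v j := by
        intro v
        rw [← Finset.sum_erase_add _ _ (Finset.mem_univ j), if_pos (Finset.mem_insert_self j s),
          flipSign_apply_self, ha]
        rw [Finset.sum_congr rfl fun i hi => by
          rw [flipSign_apply_ne (Finset.ne_of_mem_erase hi), hins v i hi]]
        push_cast
        ring
      simp only [e1, e2, e3, e4]
      have hε : |((ε j : ℤ) : ℝ)| = 1 := by
        rcases Int.units_eq_one_or (ε j) with h | h <;> simp [h]
      refine exp_sup'_add_exp_sup'_le T hT a _ _ (fun v => ?_) fun v w => ?_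
      · simpa [abs_mul, hε] using habs v j
      · rw [← mul_sub, ← mul_sub, abs_mul, abs_mul, hε, one_mul, one_mul]
        exact hdiff v w j
  simpa using key Finset.univ

end Contraction

/-! ### Rademacher sums in a Hilbert space -/

section Cosh

variable {H : Type*} [NormedAddCommGroup H] [InnerProductSpace ℝ H]
variable {ι : Type*} [Fintype ι] [DecidableEq ι]

/-- The series of `cosh` involves only powers of squares. By the parallelogram law the squares of
`‖s + x‖, ‖s - x‖` have the same sum as those of `‖s‖ + ‖x‖, ‖s‖ - ‖x‖`, and they are less spread
out, so each term is handled by convexity of a power. -/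
theorem cosh_norm_add_add_cosh_norm_sub_le (s x : H) :
    Real.cosh ‖s + x‖ + Real.cosh ‖s - x‖ ≤ 2 * (Real.cosh ‖s‖ * Real.cosh ‖x‖) := by
  have h1 : 2 * (Real.cosh ‖s‖ * Real.cosh ‖x‖) =
      Real.cosh (‖s‖ + ‖x‖) + Real.cosh (‖s‖ - ‖x‖) := by
    rw [Real.cosh_add, Real.cosh_sub]; ring
  rw [h1]
  refine hasSum_le (fun k => ?_) ((Real.hasSum_cosh ‖s + x‖).add (Real.hasSum_cosh ‖s - x‖))
    ((Real.hasSum_cosh (‖s‖ + ‖x‖)).add (Real.hasSum_cosh (‖s‖ - ‖x‖)))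
  rw [← add_div, ← add_div]
  gcongr ?_ / _
  simp only [pow_mul]
  refine pow_add_pow_le_of_add_eq (sq_nonneg _) (sq_nonneg _) ?_ ?_ ?_ k
  · gcongr; exact norm_add_le s x
  · gcongr; exact norm_sub_le s x
  · have := parallelogram_law_with_norm ℝ s x
    nlinarith

theorem sum_cosh_norm_le (x : ι → H) :
    ∑ ε : ι → ℤˣ, Real.cosh ‖∑ i, ((ε i : ℤ) : ℝ) • x i‖ ≤
      Fintype.card (ι → ℤˣ) * ∏ i, Real.cosh ‖x i‖ := by
  have key : ∀ s : Finset ι, ∑ ε : ι → ℤˣ, Real.cosh ‖∑ i ∈ s, ((ε i : ℤ) : ℝ) • x i‖ ≤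
      Fintype.card (ι → ℤˣ) * ∏ i ∈ s, Real.cosh ‖x i‖ := by
    intro s
    induction s using Finset.induction_on with
    | empty => simp
    | insert j s hj ih =>
      have hstep : ∑ ε : ι → ℤˣ, Real.cosh ‖∑ i ∈ insert j s, ((ε i : ℤ) : ℝ) • x i‖ ≤
          ∑ ε : ι → ℤˣ, Real.cosh ‖∑ i ∈ s, ((ε i : ℤ) : ℝ) • x i‖ * Real.cosh ‖x j‖ := by
        refine sum_le_sum_of_flipSign j _ _ fun ε => ?_
        have e : ∑ i ∈ s, ((flipSign j ε i : ℤ) : ℝ) • x i =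
            ∑ i ∈ s, ((ε i : ℤ) : ℝ) • x i :=
          Finset.sum_congr rfl fun i hi => by
            rw [flipSign_apply_ne (ne_of_mem_of_not_mem hi hj)]
        rw [Finset.sum_insert hj, Finset.sum_insert hj, e, flipSign_apply_self]
        have h := cosh_norm_add_add_cosh_norm_sub_le (∑ i ∈ s, ((ε i : ℤ) : ℝ) • x i)
          (((ε j : ℤ) : ℝ) • x j)
        have hn : ‖((ε j : ℤ) : ℝ) • x j‖ = ‖x j‖ := by
          rcases Int.units_eq_one_or (ε j) with h | h <;> simp [h]
        rw [hn] at h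
        have e5 : (((-ε j : ℤˣ) : ℤ) : ℝ) • x j = - (((ε j : ℤ) : ℝ) • x j) := by simp
        rw [e5, neg_add_eq_sub, add_comm (_ • x j)]
        linarith
      refine hstep.trans ?_
      rw [← Finset.sum_mul, Finset.prod_insert hj]
      have := mul_le_mul_of_nonneg_right ih (Real.cosh_pos ‖x j‖).le
      linarith
  exact key Finset.univ

theorem sum_exp_norm_le (x : ι → H) :
    ∑ ε : ι → ℤˣ, Real.exp ‖∑ i, ((ε i : ℤ) : ℝ) • x i‖ ≤
      Fintype.card (ι → ℤˣ) * (2 * ∏ i, Real.cosh ‖x i‖) := by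
  have h1 : ∀ a : ℝ, Real.exp a ≤ 2 * Real.cosh a := fun a => by
    rw [Real.cosh_eq]; linarith [Real.exp_pos (-a)]
  calc _ ≤ ∑ ε : ι → ℤˣ, 2 * Real.cosh ‖∑ i, ((ε i : ℤ) : ℝ) • x i‖ :=
        Finset.sum_le_sum fun ε _ => h1 _
    _ ≤ _ := by rw [← Finset.mul_sum]; linarith [sum_cosh_norm_le x]

/-- Exponential moments of the Rademacher process of Lipschitz functions of a linear regression. -/
theorem sum_exp_sup'_lipschitz_le (T : Finset H) (hT : T.Nonempty) (hT1 : ∀ w ∈ T, ‖w‖ ≤ 1)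
    {ℓ : ℝ → ℝ} (hℓ : LipschitzWith 1 ℓ) (hℓ0 : ℓ 0 = 0) {κ a b : ℝ} (hκ : 0 ≤ κ) (ha : 0 < a)
    (hb : 0 < b) (x : ι → H) (y : ι → ℝ) :
    ∑ ε : ι → ℤˣ, Real.exp (T.sup' hT fun w =>
        ∑ i, ((ε i : ℤ) : ℝ) * (κ * ℓ (inner ℝ w (x i) - y i))) ≤
      Fintype.card (ι → ℤˣ) *
        (2 * (a / (a + b) * ∏ i, Real.cosh (κ * (a + b) / a * ‖x i‖) +
          b / (a + b) * ∏ i, Real.cosh (κ * (a + b) / b * |y i|))) := by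
  have hL : ∀ s t, |ℓ s - ℓ t| ≤ |s - t| := fun s t => by
    simpa [Real.dist_eq] using hℓ.dist_le_mul s t
  have hL' : ∀ s t r, |ℓ (s - r) - ℓ (t - r)| ≤ |s - r - (t - r)| := fun s t r => hL _ _
  have hab : 0 < a + b := add_pos ha hb
  calc _ ≤ ∑ ε : ι → ℤˣ, Real.exp (T.sup' hT fun w =>
        ∑ i, ((ε i : ℤ) : ℝ) * (κ * (inner ℝ w (x i) - y i))) := by
        refine sum_exp_sup'_contraction T hT _ _ (fun v i => ?_) fun v w i => ?_
        · rw [abs_mul, abs_mul]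
          refine mul_le_mul_of_nonneg_left ?_ (abs_nonneg κ)
          simpa [hℓ0] using hL (inner ℝ v (x i) - y i) 0
        · rw [← mul_sub, ← mul_sub, abs_mul, abs_mul]
          exact mul_le_mul_of_nonneg_left (hL' _ _ _) (abs_nonneg κ)
    _ ≤ ∑ ε : ι → ℤˣ,
        (a / (a + b) * Real.exp ‖∑ i, ((ε i : ℤ) : ℝ) • (κ * (a + b) / a) • x i‖ +
          b / (a + b) * Real.exp ‖∑ i, ((ε i : ℤ) : ℝ) • (κ * (a + b) / b) • y i‖) := by
        refine Finset.sum_le_sum fun ε _ => ?_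
        have hx : ∑ i, ((ε i : ℤ) : ℝ) • (κ * (a + b) / a) • x i =
            (κ * (a + b) / a) • ∑ i, ((ε i : ℤ) : ℝ) • x i := by
          rw [Finset.smul_sum]
          exact Finset.sum_congr rfl fun i _ => smul_comm _ _ _
        have hy : ∑ i, ((ε i : ℤ) : ℝ) • (κ * (a + b) / b) • y i =
            (κ * (a + b) / b) • ∑ i, ((ε i : ℤ) : ℝ) • y i := by
          rw [Finset.smul_sum]
          exact Finset.sum_congr rfl fun i _ => smul_comm _ _ _
        set S := ∑ i, ((ε i : ℤ) : ℝ) • x i with hS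
        set R := ∑ i, ((ε i : ℤ) : ℝ) • y i with hR
        -- The exponent `κ * (‖S‖ + |R|)` is a convex combination of two dilated norms, so `x` and
        -- `y` separate with no independence between them. The weights give both parts the same
        -- scale once their moment norms are at most `a` and `b`.
        have hconv := convexOn_exp.2 (Set.mem_univ ‖(κ * (a + b) / a) • S‖)
          (Set.mem_univ ‖(κ * (a + b) / b) • R‖) (div_pos ha hab).le (div_pos hb hab).le
          (by field_simp)
        rw [hx, hy]
        refine le_trans (Real.exp_le_exp.2 ?_) hconv
        have h0a : 0 ≤ κ * (a + b) / a := by positivity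
        have h0b : 0 ≤ κ * (a + b) / b := by positivity
        have e : (a / (a + b)) • ‖(κ * (a + b) / a) • S‖ + (b / (a + b)) • ‖(κ * (a + b) / b) • R‖
            = κ * (‖S‖ + |R|) := by
          rw [norm_smul, norm_smul, Real.norm_of_nonneg h0a, Real.norm_of_nonneg h0b,
            Real.norm_eq_abs, smul_eq_mul, smul_eq_mul]
          field_simp
        rw [e]
        refine Finset.sup'_le _ _ fun w hw => ?_
        have e2 : ∑ i, ((ε i : ℤ) : ℝ) * (κ * (inner ℝ w (x i) - y i)) =
            κ * (inner ℝ w S - R) := by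
          rw [hS, hR, inner_sum, ← Finset.sum_sub_distrib, Finset.mul_sum]
          refine Finset.sum_congr rfl fun i _ => ?_
          rw [inner_smul_right, smul_eq_mul]; ring
        rw [e2]
        gcongr
        have h3 := real_inner_le_norm w S
        have h4 : ‖w‖ * ‖S‖ ≤ 1 * ‖S‖ := by gcongr; exact hT1 w hw
        linarith [neg_abs_le R]
    _ ≤ a / (a + b) * (Fintype.card (ι → ℤˣ) *
          (2 * ∏ i, Real.cosh ‖(κ * (a + b) / a) • x i‖)) +
        b / (a + b) * (Fintype.card (ι → ℤˣ) *
          (2 * ∏ i, Real.cosh ‖(κ * (a + b) / b) • y i‖)) := by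
        rw [Finset.sum_add_distrib, ← Finset.mul_sum, ← Finset.mul_sum]
        gcongr
        · exact sum_exp_norm_le _
        · exact sum_exp_norm_le _
    _ = _ := by
        have h0a : 0 ≤ κ * (a + b) / a := by positivity
        have h0b : 0 ≤ κ * (a + b) / b := by positivity
        simp only [norm_smul, Real.norm_of_nonneg h0a, Real.norm_of_nonneg h0b, Real.norm_eq_abs]
        ring

end Cosh

/-! ### Symmetrization -/

/-- Jensen's inequality for the exponential, valid also when its integral is infinite. -/
theorem ofReal_exp_integral_le_lintegral {Ω : Type*} [MeasurableSpace Ω] {μ : Measure Ω}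
    [IsProbabilityMeasure μ] {f : Ω → ℝ} (hf : Integrable f μ) :
    ENNReal.ofReal (Real.exp (∫ ω, f ω ∂μ)) ≤ ∫⁻ ω, ENNReal.ofReal (Real.exp (f ω)) ∂μ := by
  by_cases h : Integrable (fun ω => Real.exp (f ω)) μ
  · rw [← ofReal_integral_eq_lintegral_ofReal h (ae_of_all _ fun ω => (Real.exp_pos _).le)]
    exact ENNReal.ofReal_le_ofReal (convexOn_exp.map_integral_le Real.continuous_exp.continuousOn
      isClosed_univ (by simp) hf h)
  · have : ∫⁻ ω, ENNReal.ofReal (Real.exp (f ω)) ∂μ = ∞ := by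
      by_contra hne
      refine h ⟨Real.continuous_exp.comp_aestronglyMeasurable hf.1, ?_⟩
      rw [hasFiniteIntegral_iff_ofReal (ae_of_all _ fun ω => (Real.exp_pos _).le)]
      exact lt_top_iff_ne_top.2 hne
    rw [this]
    exact le_top

section Symmetrization

variable {S : Type*} [MeasurableSpace S] {ι : Type*} [Fintype ι]

/-- Exchanging the coordinates of two i.i.d. samples at the negative signs of `ε`. -/
theorem measurePreserving_swap_signs (ν : Measure S) [IsProbabilityMeasure ν] (ε : ι → ℤˣ) :
    MeasurePreserving (fun p : (ι → S) × (ι → S) =>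
        ((fun i => if ε i = 1 then p.1 i else p.2 i), fun i => if ε i = 1 then p.2 i else p.1 i))
      ((Measure.pi fun _ => ν).prod (Measure.pi fun _ => ν))
      ((Measure.pi fun _ => ν).prod (Measure.pi fun _ => ν)) := by
  have he := measurePreserving_arrowProdEquivProdArrow S S ι (fun _ => ν) (fun _ => ν)
  have hs : MeasurePreserving
      (fun (z : ι → S × S) i => (if ε i = 1 then id else Prod.swap : S × S → S × S) (z i))
      (Measure.pi fun _ => ν.prod ν) (Measure.pi fun _ => ν.prod ν) := by
    refine measurePreserving_pi _ _ fun i => ?_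
    split_ifs
    · exact MeasurePreserving.id _
    · exact Measure.measurePreserving_swap
  have h := he.comp (hs.comp he.symm)
  convert h using 1
  funext p
  ext i
  · by_cases hi : ε i = 1 <;>
      simp [hi, MeasurableEquiv.arrowProdEquivProdArrow, Equiv.arrowProdEquivProdArrow]
  · by_cases hi : ε i = 1 <;>
      simp [hi, MeasurableEquiv.arrowProdEquivProdArrow, Equiv.arrowProdEquivProdArrow]

theorem measurable_sup'_sum {W : Type*} (T : Finset W) (hT : T.Nonempty) {F : W → ι → S → ℝ}
    (hF : ∀ w i, Measurable (F w i)) :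
    Measurable fun z : ι → S => T.sup' hT fun w => ∑ i, F w i (z i) := by
  have : (fun z : ι → S => T.sup' hT fun w => ∑ i, F w i (z i)) =
      T.sup' hT fun w (z : ι → S) => ∑ i, F w i (z i) := by
    funext z; rw [Finset.sup'_apply]
  rw [this]
  refine Finset.measurable_sup' _ fun w _ => ?_
  exact Finset.measurable_sum _ fun i _ => (hF w i).comp (measurable_pi_apply i)

theorem exp_le_half_add_half (u v : ℝ) :
    Real.exp (u + v) ≤ (Real.exp (2 * u) + Real.exp (2 * v)) / 2 := by
  have h1 : Real.exp (2 * u) = Real.exp u ^ 2 := by rw [← Real.exp_nat_mul]; norm_num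
  have h2 : Real.exp (2 * v) = Real.exp v ^ 2 := by rw [← Real.exp_nat_mul]; norm_num
  rw [h1, h2, Real.exp_add]
  nlinarith [sq_nonneg (Real.exp u - Real.exp v)]

/-- Symmetrization for exponential moments of the supremum of an empirical process. -/
theorem card_mul_lintegral_exp_sup'_le [DecidableEq ι] {W : Type*} (ν : Measure S) [IsProbabilityMeasure ν]
    (T : Finset W) (hT : T.Nonempty) (G : W → S → ℝ) (hG : ∀ w, Measurable (G w))
    (hGi : ∀ w, Integrable (G w) ν) :
    (Fintype.card (ι → ℤˣ) : ℝ≥0∞) * ∫⁻ z, ENNReal.ofReal (Real.exp (T.sup' hT fun w =>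
        ∑ i : ι, (G w (z i) - ∫ s, G w s ∂ν))) ∂(Measure.pi fun _ : ι => ν) ≤
      ∫⁻ z, ENNReal.ofReal (∑ ε : ι → ℤˣ, Real.exp (T.sup' hT fun w =>
        ∑ i, ((ε i : ℤ) : ℝ) * (2 * G w (z i)))) ∂(Measure.pi fun _ : ι => ν) := by
  set P : Measure (ι → S) := Measure.pi fun _ : ι => ν with hP
  set I : (ι → ℤˣ) → ℝ≥0∞ := fun ε => ∫⁻ z, ENNReal.ofReal (Real.exp (T.sup' hT fun w =>
    ∑ i, ((ε i : ℤ) : ℝ) * (2 * G w (z i)))) ∂P with hI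
  set J : (ι → ℤˣ) → ℝ≥0∞ := fun ε => ∫⁻ p, ENNReal.ofReal (Real.exp (T.sup' hT fun w =>
    ∑ i, ((ε i : ℤ) : ℝ) * (G w (p.1 i) - G w (p.2 i)))) ∂(P.prod P) with hJ
  have hmJ : ∀ ε : ι → ℤˣ, Measurable fun p : (ι → S) × (ι → S) =>
      ENNReal.ofReal (Real.exp (T.sup' hT fun w =>
        ∑ i, ((ε i : ℤ) : ℝ) * (G w (p.1 i) - G w (p.2 i)))) := by
    intro ε
    have h := measurable_sup'_sum (S := S × S) (ι := ι) T hT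
      (F := fun w i s => ((ε i : ℤ) : ℝ) * (G w s.1 - G w s.2))
      (fun w i => (((hG w).comp measurable_fst).sub ((hG w).comp measurable_snd)).const_mul _)
    exact (h.comp (MeasurableEquiv.arrowProdEquivProdArrow S S ι).symm.measurable).exp.ennreal_ofReal
  have hmI : ∀ ε : ι → ℤˣ, Measurable fun z : ι → S => ENNReal.ofReal (Real.exp (T.sup' hT fun w =>
      ∑ i, ((ε i : ℤ) : ℝ) * (2 * G w (z i)))) := fun ε =>
    (measurable_sup'_sum T hT (F := fun w i s => ((ε i : ℤ) : ℝ) * (2 * G w s))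
      fun w i => ((hG w).const_mul 2).const_mul _).exp.ennreal_ofReal
  -- A second sample replaces the mean. The maximizing weight depends on `z` only, so Jensen's
  -- inequality is applied to one function of `z'`.
  have step1 : ∫⁻ z, ENNReal.ofReal (Real.exp (T.sup' hT fun w =>
      ∑ i : ι, (G w (z i) - ∫ s, G w s ∂ν))) ∂P ≤ J 1 := by
    rw [hJ]
    simp only
    rw [lintegral_prod _ (hmJ 1).aemeasurable]
    refine lintegral_mono fun z => ?_
    obtain ⟨w, hw, hw'⟩ := T.exists_mem_eq_sup' hT fun w =>
      ∑ i : ι, (G w (z i) - ∫ s, G w s ∂ν)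
    simp only
    rw [hw']
    have hint : ∀ i : ι, Integrable (fun z' : ι → S => G w (z i) - G w (z' i)) P := fun i =>
      (integrable_const _).sub (integrable_comp_eval (hGi w))
    have heq : ∑ i : ι, (G w (z i) - ∫ s, G w s ∂ν) =
        ∫ z', ∑ i : ι, (G w (z i) - G w (z' i)) ∂P := by
      rw [integral_finsetSum _ fun i _ => hint i]
      refine Finset.sum_congr rfl fun i _ => ?_
      rw [integral_sub (integrable_const _) (integrable_comp_eval (hGi w)),
        integral_comp_eval (hGi w).1]
      simp
    rw [heq]
    refine (ofReal_exp_integral_le_lintegral (integrable_finsetSum _ fun i _ => hint i)).trans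
      (lintegral_mono fun z' => ENNReal.ofReal_le_ofReal (Real.exp_le_exp.2 ?_))
    simp only [Pi.one_apply, Units.val_one, Int.cast_one, one_mul]
    exact T.le_sup' (fun w => ∑ i : ι, (G w (z i) - G w (z' i))) hw
  have step2 : ∀ ε, J ε = J 1 := by
    intro ε
    rw [hJ]
    simp only
    rw [← (measurePreserving_swap_signs ν ε).lintegral_comp (hmJ ε)]
    refine lintegral_congr fun p => ?_
    congr 3
    funext w
    refine Finset.sum_congr rfl fun i _ => ?_
    rcases Int.units_eq_one_or (ε i) with h | h <;> simp [h]
  -- The supremum of a difference is split between the samples, the second taking the signs `-ε`.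
  -- Convexity of `exp` at the midpoint costs the factor 2 in front of `G`.
  have step3 : ∀ ε, J ε ≤ (I ε + I (-ε)) / 2 := by
    intro ε
    have hb : ∀ p : (ι → S) × (ι → S), ENNReal.ofReal (Real.exp (T.sup' hT fun w =>
        ∑ i, ((ε i : ℤ) : ℝ) * (G w (p.1 i) - G w (p.2 i)))) ≤
        (ENNReal.ofReal (Real.exp (T.sup' hT fun w => ∑ i, ((ε i : ℤ) : ℝ) * (2 * G w (p.1 i)))) +
        ENNReal.ofReal (Real.exp (T.sup' hT fun w =>
          ∑ i, (((-ε) i : ℤ) : ℝ) * (2 * G w (p.2 i))))) / 2 := by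
      intro p
      rw [← ENNReal.ofReal_add (Real.exp_pos _).le (Real.exp_pos _).le,
        show (2 : ℝ≥0∞) = ENNReal.ofReal 2 by simp, ← ENNReal.ofReal_div_of_pos two_pos]
      refine ENNReal.ofReal_le_ofReal ?_
      set A := T.sup' hT fun w => ∑ i, ((ε i : ℤ) : ℝ) * (2 * G w (p.1 i)) with hA
      set B := T.sup' hT fun w => ∑ i, (((-ε) i : ℤ) : ℝ) * (2 * G w (p.2 i)) with hB
      have h := exp_le_half_add_half (A / 2) (B / 2)
      rw [mul_div_cancel₀ _ two_ne_zero, mul_div_cancel₀ _ two_ne_zero] at h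
      refine le_trans (Real.exp_le_exp.2 (Finset.sup'_le _ _ fun w hw => ?_)) h
      have h1 := T.le_sup' (fun w => ∑ i, ((ε i : ℤ) : ℝ) * (2 * G w (p.1 i))) hw
      have h2 := T.le_sup' (fun w => ∑ i, (((-ε) i : ℤ) : ℝ) * (2 * G w (p.2 i))) hw
      have h3 : ∑ i, ((ε i : ℤ) : ℝ) * (G w (p.1 i) - G w (p.2 i)) =
          (∑ i, ((ε i : ℤ) : ℝ) * (2 * G w (p.1 i))) / 2 +
          (∑ i, (((-ε) i : ℤ) : ℝ) * (2 * G w (p.2 i))) / 2 := by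
        rw [Finset.sum_div, Finset.sum_div, ← Finset.sum_add_distrib]
        refine Finset.sum_congr rfl fun i _ => ?_
        simp only [Pi.neg_apply, Units.val_neg, Int.cast_neg]
        ring
      rw [h3]
      exact add_le_add (div_le_div_of_nonneg_right h1 two_pos.le)
        (div_le_div_of_nonneg_right h2 two_pos.le)
    refine (lintegral_mono hb).trans (le_of_eq ?_)
    simp only [div_eq_mul_inv]
    rw [lintegral_mul_const' _ _ (by simp), lintegral_add_left
      (f := fun p : (ι → S) × (ι → S) => ENNReal.ofReal (Real.exp (T.sup' hT fun w =>
        ∑ i, ((ε i : ℤ) : ℝ) * (2 * G w (p.1 i))))) ((hmI ε).comp measurable_fst),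
      (measurePreserving_fst (μ := P) (ν := P)).lintegral_comp (hmI ε),
      (measurePreserving_snd (μ := P) (ν := P)).lintegral_comp (hmI (-ε))]
  have step4 : (Fintype.card (ι → ℤˣ) : ℝ≥0∞) * J 1 ≤ ∑ ε, I ε := by
    calc (Fintype.card (ι → ℤˣ) : ℝ≥0∞) * J 1 = ∑ ε, J ε := by
          rw [Finset.sum_congr rfl fun ε _ => step2 ε]
          simp
      _ ≤ ∑ ε, (I ε + I (-ε)) / 2 := Finset.sum_le_sum fun ε _ => step3 ε
      _ = ∑ ε, I ε := by
          have hneg : ∑ ε, I (-ε) = ∑ ε, I ε := Equiv.sum_comp (Equiv.neg _) I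
          simp only [div_eq_mul_inv]
          rw [← Finset.sum_mul, Finset.sum_add_distrib, hneg, ← two_mul,
            mul_comm, ← mul_assoc, ENNReal.inv_mul_cancel (by simp) (by simp), one_mul]
  calc _ ≤ (Fintype.card (ι → ℤˣ) : ℝ≥0∞) * J 1 := by gcongr
    _ ≤ ∑ ε, I ε := step4
    _ = _ := by
      rw [hI, ← lintegral_finsetSum _ fun ε _ => hmI ε]
      refine lintegral_congr fun z => ?_
      rw [ENNReal.ofReal_sum_of_nonneg fun ε _ => (Real.exp_pos _).le]

end Symmetrization

/-! ### From moment norms to exponential moments -/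

namespace IsOrliczNFunction

variable {φ : ℝ → ℝ}

theorem exists_eq (hφ : IsOrliczNFunction φ) {p : ℝ} (hp : 0 ≤ p) : ∃ x ∈ Set.Ici (0 : ℝ), φ x = p := by
  obtain ⟨x, hx, hx1⟩ := ((hφ.tendsto_atTop.eventually_ge_atTop p).and
    (eventually_ge_atTop 1)).exists
  have hxp : p ≤ φ x := by
    rw [le_div_iff₀ (by linarith)] at hx
    nlinarith
  obtain ⟨y, hy, hyp⟩ := intermediate_value_Icc (zero_le_one.trans hx1)
    hφ.continuous.continuousOn (show p ∈ Set.Icc (φ 0) (φ x) from ⟨by rwa [hφ.map_zero], hxp⟩)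
  exact ⟨y, hy.1, hyp⟩

theorem map_orliczInv (hφ : IsOrliczNFunction φ) {p : ℝ} (hp : 0 ≤ p) : φ (orliczInv φ p) = p :=
  Function.invFunOn_eq (hφ.exists_eq hp)

/-- Under the normalization `φ⁽⁻¹⁾ 1 = 1` the inverse grows at most linearly. -/
theorem orliczInv_le_self (hφ : IsOrliczNFunction φ) (h1 : orliczInv φ 1 = 1) {p : ℝ}
    (hp : 1 ≤ p) : orliczInv φ p ≤ p := by
  by_contra! hlt
  set x := orliczInv φ p with hx
  have hφx : φ x = p := hφ.map_orliczInv (by linarith)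
  have hφ1 : φ 1 = 1 := by simpa [h1] using hφ.map_orliczInv zero_le_one
  have hx0 : 0 < x := by linarith
  have hx1 : x⁻¹ ≤ 1 := inv_le_one_of_one_le₀ (by linarith)
  -- The point `1` lies between `0` and `x`, so convexity gives `1 = φ 1 ≤ φ x / x = p / x`.
  have h := hφ.convexOn.2 (Set.mem_univ x) (Set.mem_univ 0) (inv_nonneg.2 hx0.le)
    (sub_nonneg.2 hx1) (by ring)
  rw [smul_zero, add_zero, smul_eq_mul, inv_mul_cancel₀ hx0.ne', hφ1, hφ.map_zero, smul_zero,
    add_zero, hφx, smul_eq_mul, inv_mul_eq_div, le_div_iff₀ hx0] at h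
  linarith

end IsOrliczNFunction

section Moments

variable {Ω : Type*} [MeasurableSpace Ω] {μ : Measure Ω} {φ : ℝ → ℝ} {U : Ω → ℝ}

theorem eLpNorm_le_momentNorm_mul (hφ : IsOrliczNFunction φ) (h1 : orliczInv φ 1 = 1)
    (hfin : momentNorm φ U μ ≠ ∞) {p : ℝ} (hp : 1 ≤ p) :
    eLpNorm U (ENNReal.ofReal p) μ ≤ momentNorm φ U μ * ENNReal.ofReal p := by
  have h : eLpNorm U (ENNReal.ofReal p) μ / ENNReal.ofReal (orliczInv φ p) ≤ momentNorm φ U μ :=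
    le_iSup₂_of_le p hp le_rfl
  -- Finiteness of the norm makes it unnecessary to know that the denominator is nonzero.
  rw [ENNReal.div_le_iff_le_mul (Or.inr hfin) (Or.inl ENNReal.ofReal_ne_top)] at h
  exact h.trans (by gcongr; exact hφ.orliczInv_le_self h1 hp)

theorem integrable_of_momentNorm_ne_top (hφ : IsOrliczNFunction φ) (h1 : orliczInv φ 1 = 1)
    (hU : AEStronglyMeasurable U μ) (hfin : momentNorm φ U μ ≠ ∞) : Integrable U μ := by
  rw [← memLp_one_iff_integrable]
  refine ⟨hU, ?_⟩
  have h := eLpNorm_le_momentNorm_mul hφ h1 hfin le_rfl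
  rw [ENNReal.ofReal_one, mul_one] at h
  exact h.trans_lt (lt_top_iff_ne_top.2 hfin)

theorem momentNorm_const_mul (c : ℝ) (hc : 0 ≤ c) (φ : ℝ → ℝ) (U : Ω → ℝ) (μ : Measure Ω) :
    momentNorm φ (fun ω => c * U ω) μ = ENNReal.ofReal c * momentNorm φ U μ := by
  simp only [momentNorm, ENNReal.mul_iSup]
  refine iSup_congr fun p => iSup_congr fun _ => ?_
  have : (fun ω => c * U ω) = c • U := rfl
  rw [this, eLpNorm_const_smul, mul_div_assoc, Real.enorm_eq_ofReal hc]

theorem lintegral_pow_le_of_momentNorm_le (hφ : IsOrliczNFunction φ) (h1 : orliczInv φ 1 = 1)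
    {a : ℝ} (ha : 0 ≤ a) (hU : momentNorm φ U μ ≤ ENNReal.ofReal a) {k : ℕ} (hk : k ≠ 0) :
    ∫⁻ ω, ENNReal.ofReal (U ω ^ (2 * k)) ∂μ ≤
      ENNReal.ofReal ((a * (2 * k : ℕ)) ^ (2 * k)) := by
  have hk1 : (1 : ℝ) ≤ (2 * k : ℕ) := by
    have : 1 ≤ 2 * k := by omega
    exact_mod_cast this
  have hfin : momentNorm φ U μ ≠ ∞ := ne_top_of_le_ne_top ENNReal.ofReal_ne_top hU
  have h := (eLpNorm_le_momentNorm_mul hφ h1 hfin hk1).trans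
    (mul_le_mul_left hU (ENNReal.ofReal (2 * k : ℕ)))
  have hp0 : ENNReal.ofReal ((2 * k : ℕ) : ℝ) ≠ 0 := by
    rw [Ne, ENNReal.ofReal_eq_zero]; linarith
  rw [← ENNReal.ofReal_mul ha, eLpNorm_eq_lintegral_rpow_enorm_toReal hp0 ENNReal.ofReal_ne_top,
    ENNReal.toReal_ofReal (by linarith)] at h
  have h2 := ENNReal.rpow_le_rpow h (show (0 : ℝ) ≤ (2 * k : ℕ) by linarith)
  rw [← ENNReal.rpow_mul, one_div, inv_mul_cancel₀ (by linarith), ENNReal.rpow_one,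
    ENNReal.rpow_natCast, ← ENNReal.ofReal_pow (by positivity)] at h2
  refine le_trans (lintegral_mono fun ω => ?_) h2
  rw [ENNReal.rpow_natCast, Real.enorm_eq_ofReal_abs, ← ENNReal.ofReal_pow (abs_nonneg _),
    pow_mul, pow_mul, sq_abs]

/-- Only even powers occur, so no centring is needed. The `k`-th term of the series has mean at most
`q ^ (2 * k)` with `q = e * s * a`, and the geometric sum is at most `1 + 2 * q ^ 2` for `q ≤ 1 /
2`. -/
theorem lintegral_cosh_le_of_momentNorm_le (hφ : IsOrliczNFunction φ) (h1 : orliczInv φ 1 = 1)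
    [IsProbabilityMeasure μ] (hUm : AEMeasurable U μ) {a : ℝ} (ha : 0 ≤ a)
    (hU : momentNorm φ U μ ≤ ENNReal.ofReal a) {s : ℝ} (hs : 0 ≤ s)
    (hq : Real.exp 1 * s * a ≤ 1 / 2) :
    ∫⁻ ω, ENNReal.ofReal (Real.cosh (s * U ω)) ∂μ ≤
      ENNReal.ofReal (Real.exp (2 * (Real.exp 1 * s * a) ^ 2)) := by
  set q := Real.exp 1 * s * a with hqdef
  have hq0 : 0 ≤ q := by positivity
  have hq2 : q ^ 2 ≤ 1 / 4 := by nlinarith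
  have hterm : ∀ k : ℕ, ∫⁻ ω, ENNReal.ofReal ((s * U ω) ^ (2 * k) / (2 * k).factorial) ∂μ ≤
      ENNReal.ofReal ((q ^ 2) ^ k) := by
    intro k
    rcases eq_or_ne k 0 with rfl | hk
    · simp
    · have e1 : ∀ ω, ENNReal.ofReal ((s * U ω) ^ (2 * k) / (2 * k).factorial) =
          ENNReal.ofReal (s ^ (2 * k) / (2 * k).factorial) * ENNReal.ofReal (U ω ^ (2 * k)) := by
        intro ω
        rw [← ENNReal.ofReal_mul (by positivity), mul_pow]
        congr 1; ring
      simp only [e1]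
      rw [lintegral_const_mul' _ _ ENNReal.ofReal_ne_top]
      refine (mul_le_mul_right (lintegral_pow_le_of_momentNorm_le hφ h1 ha hU hk) _).trans ?_
      rw [← ENNReal.ofReal_mul (by positivity)]
      refine ENNReal.ofReal_le_ofReal ?_
      have h3 := Real.pow_div_factorial_le_exp ((2 * k : ℕ) : ℝ) (by positivity) (2 * k)
      have e2 : Real.exp ((2 * k : ℕ) : ℝ) = Real.exp 1 ^ (2 * k) := by
        rw [← Real.exp_nat_mul, mul_one]
      rw [e2] at h3
      calc s ^ (2 * k) / (2 * k).factorial * (a * (2 * k : ℕ)) ^ (2 * k)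
          = (s * a) ^ (2 * k) * (((2 * k : ℕ) : ℝ) ^ (2 * k) / (2 * k).factorial) := by
            rw [mul_pow, mul_pow]; ring
        _ ≤ (s * a) ^ (2 * k) * Real.exp 1 ^ (2 * k) := by gcongr
        _ = (q ^ 2) ^ k := by rw [← mul_pow, ← pow_mul, hqdef]; ring
  have hcosh : ∀ ω, ENNReal.ofReal (Real.cosh (s * U ω)) =
      ∑' k : ℕ, ENNReal.ofReal ((s * U ω) ^ (2 * k) / (2 * k).factorial) := by
    intro ω
    rw [Real.cosh_eq_tsum, ENNReal.ofReal_tsum_of_nonneg _ (Real.hasSum_cosh _).summable]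
    intro k
    rw [pow_mul]
    positivity
  simp only [hcosh]
  rw [lintegral_tsum fun k => by fun_prop]
  calc ∑' k : ℕ, ∫⁻ ω, ENNReal.ofReal ((s * U ω) ^ (2 * k) / (2 * k).factorial) ∂μ
      ≤ ∑' k : ℕ, ENNReal.ofReal ((q ^ 2) ^ k) := ENNReal.tsum_le_tsum hterm
    _ = ENNReal.ofReal (1 - q ^ 2)⁻¹ := by
        rw [← tsum_geometric_of_lt_one (sq_nonneg q) (by linarith),
          ENNReal.ofReal_tsum_of_nonneg (fun k => by positivity)
            (summable_geometric_of_lt_one (sq_nonneg q) (by linarith))]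
    _ ≤ _ := by
        refine ENNReal.ofReal_le_ofReal ?_
        have h4 := Real.add_one_le_exp (2 * q ^ 2)
        refine le_trans ?_ h4
        rw [inv_le_iff_one_le_mul₀ (by linarith)]
        nlinarith [sq_nonneg q]

end Moments

/-! ### Chernoff bound for finitely many weights -/

theorem lintegral_pi_prod {S ι : Type*} [MeasurableSpace S] [Fintype ι] (ν : Measure S)
    [IsProbabilityMeasure ν] {f : S → ℝ≥0∞} (hf : Measurable f) :
    ∫⁻ z : ι → S, ∏ i, f (z i) ∂(Measure.pi fun _ => ν) = (∫⁻ s, f s ∂ν) ^ Fintype.card ι := by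
  rw [lintegral_prod_eq_prod_lintegral_of_indepFun Finset.univ
    (fun i (z : ι → S) => f (z i)) (iIndepFun_pi fun _ => hf.aemeasurable)
    fun i => hf.comp (measurable_pi_apply i)]
  have h : ∀ i : ι, ∫⁻ z : ι → S, f (z i) ∂(Measure.pi fun _ => ν) = ∫⁻ s, f s ∂ν := fun i =>
    (measurePreserving_eval (fun _ : ι => ν) i).lintegral_comp hf
  simp [h]

section Regression

variable {H : Type*} [NormedAddCommGroup H] [InnerProductSpace ℝ H]
  [MeasurableSpace H] [BorelSpace H]

theorem measurable_lipschitz_inner_sub {ℓ : ℝ → ℝ} (hℓ : LipschitzWith 1 ℓ) (w : H) :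
    Measurable fun z : H × ℝ => ℓ (inner ℝ w z.1 - z.2) := by
  have h : Measurable fun x : H => inner ℝ w x :=
    (continuous_const.inner continuous_id).measurable
  exact hℓ.continuous.measurable.comp ((h.comp measurable_fst).sub measurable_snd)

/-- Exponential moments of the uniform deviation over finitely many weights. -/
theorem lintegral_exp_sup'_deviation_le {ι : Type*} [Fintype ι] (ν : Measure (H × ℝ))
    [IsProbabilityMeasure ν] {ℓ : ℝ → ℝ} (hℓ : LipschitzWith 1 ℓ) (hℓ0 : ℓ 0 = 0)
    (hint : ∀ w : H, Integrable (fun z : H × ℝ => ℓ (inner ℝ w z.1 - z.2)) ν)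
    (T : Finset H) (hT : T.Nonempty) (hT1 : ∀ w ∈ T, ‖w‖ ≤ 1) {r a b K : ℝ} (hr : 0 ≤ r)
    (ha : 0 < a) (hb : 0 < b) (hK : 0 ≤ K)
    (hx : ∫⁻ z, ENNReal.ofReal (Real.cosh (2 * r * (a + b) / a * ‖z.1‖)) ∂ν ≤ ENNReal.ofReal K)
    (hy : ∫⁻ z, ENNReal.ofReal (Real.cosh (2 * r * (a + b) / b * |z.2|)) ∂ν ≤ ENNReal.ofReal K) :
    ∫⁻ z, ENNReal.ofReal (Real.exp (T.sup' hT fun w => ∑ i : ι, (r * ℓ (inner ℝ w (z i).1 - (z i).2)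
        - ∫ s, r * ℓ (inner ℝ w s.1 - s.2) ∂ν))) ∂(Measure.pi fun _ : ι => ν) ≤
      ENNReal.ofReal (2 * K ^ Fintype.card ι) := by
  classical
  have hsym := card_mul_lintegral_exp_sup'_le (ι := ι) ν T hT
    (fun w z => r * ℓ (inner ℝ w z.1 - z.2))
    (fun w => (measurable_lipschitz_inner_sub hℓ w).const_mul r) (fun w => (hint w).const_mul r)
  have hab : 0 < a + b := add_pos ha hb
  set P : Measure (ι → H × ℝ) := Measure.pi fun _ : ι => ν with hP
  set N := Fintype.card (ι → ℤˣ) with hN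
  have hN0 : (N : ℝ≥0∞) ≠ 0 := by simp [hN]
  set fx : H × ℝ → ℝ≥0∞ := fun z => ENNReal.ofReal (Real.cosh (2 * r * (a + b) / a * ‖z.1‖)) with hfx
  set fy : H × ℝ → ℝ≥0∞ := fun z => ENNReal.ofReal (Real.cosh (2 * r * (a + b) / b * |z.2|)) with hfy
  have hmx : Measurable fx :=
    (Real.measurable_cosh.comp (measurable_fst.norm.const_mul _)).ennreal_ofReal
  have hmy : Measurable fy :=
    (Real.measurable_cosh.comp (measurable_snd.norm.const_mul _)).ennreal_ofReal
  have hprod : ∀ f : H × ℝ → ℝ≥0∞, Measurable f → ∫⁻ s, f s ∂ν ≤ ENNReal.ofReal K →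
      ∫⁻ z, ∏ i, f (z i) ∂P ≤ ENNReal.ofReal (K ^ Fintype.card ι) := by
    intro f hf hfK
    rw [hP, lintegral_pi_prod ν hf, ENNReal.ofReal_pow hK]
    gcongr
  have hmp : ∀ f : H × ℝ → ℝ≥0∞, Measurable f → Measurable fun z : ι → H × ℝ => ∏ i, f (z i) :=
    fun f hf => Finset.measurable_prod _ fun i _ => hf.comp (measurable_pi_apply i)
  refine (ENNReal.mul_le_mul_iff_right hN0 (ENNReal.natCast_ne_top N)).1 (hsym.trans ?_)
  calc _ ≤ ∫⁻ z, N * (2 * (ENNReal.ofReal (a / (a + b)) * ∏ i, fx (z i) +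
        ENNReal.ofReal (b / (a + b)) * ∏ i, fy (z i))) ∂P := by
        refine lintegral_mono fun z => ?_
        have h := sum_exp_sup'_lipschitz_le T hT hT1 hℓ hℓ0 (κ := 2 * r) (by positivity) ha hb
          (fun i => (z i).1) (fun i => (z i).2)
        have e : ∀ w i, 2 * (r * ℓ (inner ℝ w (z i).1 - (z i).2)) =
          2 * r * ℓ (inner ℝ w (z i).1 - (z i).2) := fun w i => by ring
        simp only [e]
        refine (ENNReal.ofReal_le_ofReal h).trans (le_of_eq ?_)
        have hpx : 0 ≤ ∏ i, Real.cosh (2 * r * (a + b) / a * ‖(z i).1‖) :=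
          Finset.prod_nonneg fun i _ => (Real.cosh_pos _).le
        have hpy : 0 ≤ ∏ i, Real.cosh (2 * r * (a + b) / b * |(z i).2|) :=
          Finset.prod_nonneg fun i _ => (Real.cosh_pos _).le
        have e1 := ENNReal.ofReal_prod_of_nonneg (s := Finset.univ)
          (f := fun i => Real.cosh (2 * r * (a + b) / a * ‖(z i).1‖))
          fun i _ => (Real.cosh_pos _).le
        have e2 := ENNReal.ofReal_prod_of_nonneg (s := Finset.univ)
          (f := fun i => Real.cosh (2 * r * (a + b) / b * |(z i).2|))
          fun i _ => (Real.cosh_pos _).le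
        rw [ENNReal.ofReal_mul (by positivity), ENNReal.ofReal_mul (by positivity),
          ENNReal.ofReal_add (by positivity) (by positivity), ENNReal.ofReal_mul (by positivity),
          ENNReal.ofReal_mul (by positivity), e1, e2]
        simp [hN, hfx, hfy]
    _ ≤ N * (2 * (ENNReal.ofReal (a / (a + b)) * ENNReal.ofReal (K ^ Fintype.card ι) +
        ENNReal.ofReal (b / (a + b)) * ENNReal.ofReal (K ^ Fintype.card ι))) := by
        rw [lintegral_const_mul' _ _ (ENNReal.natCast_ne_top N),
          lintegral_const_mul' _ _ ENNReal.ofNat_ne_top,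
          lintegral_add_left ((hmp fx hmx).const_mul _),
          lintegral_const_mul' _ _ ENNReal.ofReal_ne_top,
          lintegral_const_mul' _ _ ENNReal.ofReal_ne_top]
        gcongr
        · exact hprod fx hmx hx
        · exact hprod fy hmy hy
    _ = _ := by
        rw [← add_mul, ← ENNReal.ofReal_add (by positivity) (by positivity), ← add_div,
          div_self hab.ne', ENNReal.ofReal_one, one_mul, ENNReal.ofReal_mul zero_le_two]
        simp

theorem chernoff_exponent_eq {x t M e : ℝ} (hx : 0 < x) (ht : 0 ≤ t) (hM : 0 < M) (he : 0 < e) :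
    √(t / x) / (4 * e * M) * x * (12 / √x * M * (1 + e * √t)) = 3 * √t / e + 3 * t := by
  have hs : 0 < √x := Real.sqrt_pos.2 hx
  have hst : √t ^ 2 = t := Real.sq_sqrt ht
  have hsx : √x ^ 2 = x := Real.sq_sqrt hx.le
  rw [Real.sqrt_div ht]
  calc √t / √x / (4 * e * M) * x * (12 / √x * M * (1 + e * √t))
      = (x / √x ^ 2) * (3 * √t / e + 3 * √t ^ 2) := by field_simp; ring
    _ = _ := by rw [hsx, hst, div_self hx.ne', one_mul]

theorem measurable_sup'_deviation {ι : Type*} [Fintype ι] {ℓ : ℝ → ℝ} (hℓ : LipschitzWith 1 ℓ)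
    (T : Finset H) (hT : T.Nonempty) (r : ℝ) (c : H → ℝ) :
    Measurable fun z : ι → H × ℝ => T.sup' hT fun w =>
      ∑ i, (r * ℓ (inner ℝ w (z i).1 - (z i).2) - c w) := by
  have h : ∀ w : H, Measurable fun s : H × ℝ => r * ℓ (inner ℝ w s.1 - s.2) - c w := fun w =>
    ((measurable_lipschitz_inner_sub hℓ w).const_mul r).sub measurable_const
  have := measurable_sup'_sum (S := H × ℝ)
    (F := fun w (_ : ι) (s : H × ℝ) => r * ℓ (inner ℝ w s.1 - s.2) - c w) T hT fun w _ => h w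
  exact this

/-- Chernoff bound for the uniform deviation over finitely many weights in the unit ball. -/
theorem measure_exists_mem_finset_deviation_ge_le {Ω : Type*} [MeasurableSpace Ω] (μ : Measure Ω)
    [IsProbabilityMeasure μ] {φ : ℝ → ℝ} (hφ : IsOrliczNFunction φ) (hφ_one : orliczInv φ 1 = 1)
    {ℓ : ℝ → ℝ} (hℓ : LipschitzWith 1 ℓ) (hℓ0 : ℓ 0 = 0) {n : ℕ} [NeZero n] {X : Fin n → Ω → H}
    {Y : Fin n → Ω → ℝ} (h_indep : iIndepFun (fun i ω => (X i ω, Y i ω)) μ)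
    (h_ident : ∀ i, IdentDistrib (fun ω => (X i ω, Y i ω)) (fun ω => (X 0 ω, Y 0 ω)) μ μ)
    (hint : ∀ w : H, Integrable (fun ω => ℓ (inner ℝ w (X 0 ω) - Y 0 ω)) μ)
    {a b t : ℝ} (ha : 0 < a) (hb : 0 < b)
    (hXa : momentNorm φ (fun ω => ‖X 0 ω‖) μ ≤ ENNReal.ofReal a)
    (hYb : momentNorm φ (Y 0) μ ≤ ENNReal.ofReal b) (ht : 1 ≤ t) (htn : t ≤ n)
    (T : Finset H) (hT : T.Nonempty) (hT1 : ∀ w ∈ T, ‖w‖ ≤ 1) :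
    μ {ω | ∃ w ∈ T, 12 / √n * (a + b) * (1 + Real.exp 1 * √t) ≤
        1 / (n : ℝ) * ∑ i, ℓ (inner ℝ w (X i ω) - Y i ω) -
          ∫ ω', ℓ (inner ℝ w (X 0 ω') - Y 0 ω') ∂μ} ≤ ENNReal.ofReal (Real.exp (-t)) := by
  set Z : Fin n → Ω → H × ℝ := fun i ω => (X i ω, Y i ω) with hZ
  have hZm : ∀ i, AEMeasurable (Z i) μ := fun i => (h_ident i).aemeasurable_fst
  set ν : Measure (H × ℝ) := μ.map (Z 0) with hν
  have : IsProbabilityMeasure ν := Measure.isProbabilityMeasure_map (hZm 0)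
  have hlaw : μ.map (fun ω i => Z i ω) = Measure.pi fun _ : Fin n => ν := by
    rw [(iIndepFun_iff_map_fun_eq_pi_map hZm).1 h_indep]
    congr 1
    funext i
    exact (h_ident i).map_eq
  have hn : (0 : ℝ) < n := by exact_mod_cast Nat.pos_of_ne_zero (NeZero.ne n)
  have hab : 0 < a + b := add_pos ha hb
  set e := Real.exp 1 with he
  have he0 : 0 < e := Real.exp_pos 1
  -- With this `r` the parameter `q` of the `cosh` bound is `√(t / n) / 2` for both variables. It is
  -- at most `1 / 2` because `t ≤ n`, and the `n` factors multiply to `exp (t / 2)`.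
  set r := √(t / n) / (4 * e * (a + b)) with hr
  have hr0 : 0 ≤ r := by positivity
  have hq : ∀ c, 0 < c → e * (2 * r * (a + b) / c) * c = √(t / n) / 2 := by
    intro c hc
    rw [hr]; field_simp; norm_num
  have hsq : √(t / n) ≤ 1 := Real.sqrt_le_one.2 ((div_le_one hn).2 htn)
  have hsq2 : √(t / n) ^ 2 = t / n := Real.sq_sqrt (by positivity)
  set K := Real.exp (t / (2 * n)) with hK
  have hcosh : ∀ (U : Ω → ℝ) (c : ℝ), AEMeasurable U μ → 0 < c →
      momentNorm φ U μ ≤ ENNReal.ofReal c →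
      ∫⁻ ω, ENNReal.ofReal (Real.cosh (2 * r * (a + b) / c * U ω)) ∂μ ≤ ENNReal.ofReal K := by
    intro U c hU hc hUc
    have h := lintegral_cosh_le_of_momentNorm_le hφ hφ_one hU hc.le hUc
      (s := 2 * r * (a + b) / c) (by positivity) (by rw [← he, hq c hc]; linarith)
    rw [← he, hq c hc, div_pow, hsq2] at h
    refine h.trans (le_of_eq ?_)
    rw [hK]; congr 2; field_simp
  have hXm : AEMeasurable (X 0) μ := measurable_fst.comp_aemeasurable (hZm 0)
  have hYm : AEMeasurable (Y 0) μ := measurable_snd.comp_aemeasurable (hZm 0)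
  have hgm : ∀ w : H, Measurable fun z : H × ℝ => ℓ (inner ℝ w z.1 - z.2) :=
    measurable_lipschitz_inner_sub hℓ
  have hcx : Measurable fun z : H × ℝ =>
      ENNReal.ofReal (Real.cosh (2 * r * (a + b) / a * ‖z.1‖)) :=
    (Real.measurable_cosh.comp (measurable_fst.norm.const_mul _)).ennreal_ofReal
  have hcy : Measurable fun z : H × ℝ =>
      ENNReal.ofReal (Real.cosh (2 * r * (a + b) / b * |z.2|)) :=
    (Real.measurable_cosh.comp (measurable_snd.norm.const_mul _)).ennreal_ofReal
  have hmain := lintegral_exp_sup'_deviation_le (ι := Fin n) ν hℓ hℓ0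
    (fun w => (integrable_map_measure (hgm w).aestronglyMeasurable (hZm 0)).2 (hint w)) T hT hT1 hr0
    ha hb (Real.exp_pos _).le (K := K)
    (by
      rw [hν, lintegral_map' hcx.aemeasurable (hZm 0)]
      exact hcosh _ a hXm.norm ha hXa)
    (by
      rw [hν, lintegral_map' hcy.aemeasurable (hZm 0)]
      refine le_trans (le_of_eq (lintegral_congr fun ω => ?_)) (hcosh _ b hYm hb hYb)
      rw [← Real.cosh_abs (_ * Y 0 ω), abs_mul,
        abs_of_nonneg (show 0 ≤ 2 * r * (a + b) / b by positivity)])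
  obtain ⟨F, hF⟩ : ∃ F : (Fin n → H × ℝ) → ℝ, F = fun z => T.sup' hT fun w =>
      ∑ i : Fin n, (r * ℓ (inner ℝ w (z i).1 - (z i).2) -
        ∫ s, r * ℓ (inner ℝ w s.1 - s.2) ∂ν) := ⟨_, rfl⟩
  have hFm : Measurable F := by
    rw [hF]
    exact measurable_sup'_deviation hℓ T hT r fun w => ∫ s, r * ℓ (inner ℝ w s.1 - s.2) ∂ν
  have hZp : AEMeasurable (fun ω i => Z i ω) μ := aemeasurable_pi_lambda _ hZm
  have hmain' : ∫⁻ ω, ENNReal.ofReal (Real.exp (F fun i => Z i ω)) ∂μ ≤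
      ENNReal.ofReal (2 * K ^ Fintype.card (Fin n)) := by
    have hmap := lintegral_map' (f := fun z => ENNReal.ofReal (Real.exp (F z)))
      hFm.exp.ennreal_ofReal.aemeasurable hZp
    rw [hlaw] at hmap
    refine hmap.symm.le.trans ?_
    rw [hF]
    exact hmain
  -- At the threshold the exponent is `3 * √t / e + 3 * t`; the first summand is dropped.
  set c : ℝ≥0∞ := ENNReal.ofReal (Real.exp (3 * t)) with hc
  have hc0 : c ≠ 0 := by simp [hc, Real.exp_pos]
  calc μ _ ≤ μ {ω | c ≤ ENNReal.ofReal (Real.exp (F fun i => Z i ω))} := by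
        refine measure_mono ?_
        rintro ω ⟨w, hw, hdev⟩
        refine ENNReal.ofReal_le_ofReal (Real.exp_le_exp.2 ?_)
        rw [hF]
        refine le_trans ?_ (T.le_sup' (fun w => ∑ i : Fin n, (r * ℓ (inner ℝ w (Z i ω).1 - (Z i ω).2)
          - ∫ s, r * ℓ (inner ℝ w s.1 - s.2) ∂ν)) hw)
        have hI : ∫ s, r * ℓ (inner ℝ w s.1 - s.2) ∂ν =
            r * ∫ ω', ℓ (inner ℝ w (X 0 ω') - Y 0 ω') ∂μ := by
          rw [integral_const_mul, hν, integral_map (hZm 0) (hgm w).aestronglyMeasurable]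
        rw [Finset.sum_sub_distrib, ← Finset.mul_sum, hI, Finset.sum_const, Finset.card_univ,
          Fintype.card_fin, nsmul_eq_mul]
        have h1 := mul_le_mul_of_nonneg_left hdev (show 0 ≤ r * n by positivity)
        have h2 : r * n * (1 / (n : ℝ) * ∑ i, ℓ (inner ℝ w (X i ω) - Y i ω) -
            ∫ ω', ℓ (inner ℝ w (X 0 ω') - Y 0 ω') ∂μ) =
            r * ∑ i, ℓ (inner ℝ w (X i ω) - Y i ω) -
            n * (r * ∫ ω', ℓ (inner ℝ w (X 0 ω') - Y 0 ω') ∂μ) := by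
          field_simp
        rw [h2] at h1
        refine le_trans ?_ h1
        have h3 : r * n * (12 / √n * (a + b) * (1 + e * √t)) = 3 * √t / e + 3 * t :=
          chernoff_exponent_eq hn (by linarith) hab he0
        rw [h3]
        have : 0 ≤ 3 * √t / e := by positivity
        linarith
    _ ≤ (∫⁻ ω, ENNReal.ofReal (Real.exp (F fun i => Z i ω)) ∂μ) / c :=
        meas_ge_le_lintegral_div (hFm.exp.ennreal_ofReal.comp_aemeasurable hZp) hc0 ENNReal.ofReal_ne_top
    _ ≤ ENNReal.ofReal (2 * K ^ Fintype.card (Fin n)) / c := by gcongr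
    _ ≤ _ := by
        rw [hc, ← ENNReal.ofReal_div_of_pos (Real.exp_pos _)]
        refine ENNReal.ofReal_le_ofReal ?_
        have hKn : K ^ Fintype.card (Fin n) = Real.exp (t / 2) := by
          rw [Fintype.card_fin, hK, ← Real.exp_nat_mul]
          congr 1; field_simp
        rw [hKn, div_le_iff₀ (Real.exp_pos _), ← Real.exp_add]
        have h2 : (2 : ℝ) ≤ Real.exp 1 := by linarith [Real.add_one_le_exp 1]
        -- Here `t ≥ 1` absorbs the prefactor: `1 + t / 2 ≤ -t + 3 * t`.
        calc 2 * Real.exp (t / 2) ≤ Real.exp 1 * Real.exp (t / 2) := by gcongr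
          _ ≤ _ := by rw [← Real.exp_add]; exact Real.exp_le_exp.2 (by linarith)

end Regression

/-! ### From finitely many weights to the unit ball -/

section Reduction

variable {H : Type*} [NormedAddCommGroup H] [InnerProductSpace ℝ H]
  {Ω : Type*} [MeasurableSpace Ω] {μ : Measure Ω} {ℓ : ℝ → ℝ}

theorem integrable_lipschitz_inner_sub [IsFiniteMeasure μ] (hℓ : LipschitzWith 1 ℓ) {X : Ω → H}
    {Y : Ω → ℝ} (hX : AEStronglyMeasurable X μ) (hXi : Integrable (fun ω => ‖X ω‖) μ)
    (hY : Integrable Y μ) (w : H) : Integrable (fun ω => ℓ (inner ℝ w (X ω) - Y ω)) μ := by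
  have hm : AEStronglyMeasurable (fun ω => inner ℝ w (X ω) - Y ω) μ :=
    (aestronglyMeasurable_const.inner hX).sub hY.1
  refine Integrable.mono' (((hXi.const_mul ‖w‖).add hY.norm).add (integrable_const |ℓ 0|))
    (hℓ.continuous.comp_aestronglyMeasurable hm) (ae_of_all _ fun ω => ?_)
  have h1 : |ℓ (inner ℝ w (X ω) - Y ω) - ℓ 0| ≤ |inner ℝ w (X ω) - Y ω| := by
    simpa [Real.dist_eq] using hℓ.dist_le_mul (inner ℝ w (X ω) - Y ω) 0
  have h2 := abs_real_inner_le_norm w (X ω)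
  have h3 := abs_sub (inner ℝ w (X ω)) (Y ω)
  have h4 := abs_sub_abs_le_abs_sub (ℓ (inner ℝ w (X ω) - Y ω)) (ℓ 0)
  simp only [Pi.add_apply, Real.norm_eq_abs]
  linarith

/-- The deviation of the empirical loss from its mean at the weight `w`. -/
noncomputable def lossDeviation {n : ℕ} [NeZero n] (ℓ : ℝ → ℝ) (X : Fin n → Ω → H)
    (Y : Fin n → Ω → ℝ) (μ : Measure Ω) (w : H) (ω : Ω) : ℝ :=
  1 / (n : ℝ) * ∑ i, ℓ (inner ℝ w (X i ω) - Y i ω) - ∫ ω', ℓ (inner ℝ w (X 0 ω') - Y 0 ω') ∂μ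

theorem continuous_integral_lipschitz_inner_sub [IsFiniteMeasure μ] (hℓ : LipschitzWith 1 ℓ)
    {X : Ω → H} {Y : Ω → ℝ} (hX : AEStronglyMeasurable X μ)
    (hXi : Integrable (fun ω => ‖X ω‖) μ) (hY : Integrable Y μ) :
    Continuous fun w : H => ∫ ω, ℓ (inner ℝ w (X ω) - Y ω) ∂μ := by
  have hC : 0 ≤ ∫ ω, ‖X ω‖ ∂μ := integral_nonneg fun ω => norm_nonneg _
  refine (LipschitzWith.of_dist_le_mul (K := ⟨∫ ω, ‖X ω‖ ∂μ, hC⟩) fun v w => ?_).continuous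
  have hi := integrable_lipschitz_inner_sub hℓ hX hXi hY
  rw [Real.dist_eq, ← integral_sub (hi v) (hi w), dist_eq_norm]
  refine (abs_integral_le_integral_abs).trans ?_
  change _ ≤ (∫ ω, ‖X ω‖ ∂μ) * ‖v - w‖
  rw [← integral_mul_const]
  refine integral_mono ((hi v).sub (hi w)).abs (hXi.mul_const _) fun ω => ?_
  have h1 : |ℓ (inner ℝ v (X ω) - Y ω) - ℓ (inner ℝ w (X ω) - Y ω)| ≤
      |inner ℝ v (X ω) - Y ω - (inner ℝ w (X ω) - Y ω)| := by
    simpa [Real.dist_eq] using hℓ.dist_le_mul (inner ℝ v (X ω) - Y ω) (inner ℝ w (X ω) - Y ω)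
  rw [sub_sub_sub_cancel_right, ← inner_sub_left] at h1
  exact h1.trans ((abs_real_inner_le_norm _ _).trans (mul_comm _ _).le)

theorem continuous_lossDeviation [IsFiniteMeasure μ] (hℓ : LipschitzWith 1 ℓ) {n : ℕ} [NeZero n]
    {X : Fin n → Ω → H} {Y : Fin n → Ω → ℝ} (hX : AEStronglyMeasurable (X 0) μ)
    (hXi : Integrable (fun ω => ‖X 0 ω‖) μ) (hY : Integrable (Y 0) μ) (ω : Ω) :
    Continuous fun w => lossDeviation ℓ X Y μ w ω := by
  refine Continuous.sub (continuous_const.mul (continuous_finsetSum _ fun i _ => ?_))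
    (continuous_integral_lipschitz_inner_sub hℓ hX hXi hY)
  exact hℓ.continuous.comp ((continuous_id.inner continuous_const).sub continuous_const)

/-- Countably many weights in the unit ball suffice to approximate, almost surely, every deviation
of weights in the unit ball. -/
theorem exists_seq_lossDeviation_dense [CompleteSpace H] [IsFiniteMeasure μ]
    (hℓ : LipschitzWith 1 ℓ) {n : ℕ} [NeZero n] {X : Fin n → Ω → H} {Y : Fin n → Ω → ℝ}
    (hX : ∀ i, AEStronglyMeasurable (X i) μ) (hXi : Integrable (fun ω => ‖X 0 ω‖) μ)
    (hY : Integrable (Y 0) μ) :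
    ∃ d : ℕ → H, (∀ j, ‖d j‖ ≤ 1) ∧ ∀ᵐ ω ∂μ, ∀ w : H, ‖w‖ ≤ 1 → ∀ u,
      u < lossDeviation ℓ X Y μ w ω → ∃ j, u < lossDeviation ℓ X Y μ (d j) ω := by
  choose t ht htX using fun i => (hX i).isSeparable_ae_range
  -- The space `H` need not be separable, but almost surely all `X i` lie in this separable
  -- subspace. Projecting a weight onto it keeps the weight in the ball and changes neither the
  -- empirical loss nor its mean.
  set V : Submodule ℝ H := (Submodule.span ℝ (⋃ i, t i)).topologicalClosure with hV
  have hVsep : TopologicalSpace.IsSeparable (V : Set H) := by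
    rw [hV, Submodule.topologicalClosure_coe]
    exact (TopologicalSpace.IsSeparable.iUnion ht).span.closure
  have : CompleteSpace V := by
    rw [hV]
    exact (Submodule.isClosed_topologicalClosure _).completeSpace_coe
  obtain ⟨D, hDV, hDc, hD⟩ := (hVsep.mono
    (Set.inter_subset_right (s := Metric.closedBall (0 : H) 1))).exists_countable_dense_subset
  have hDne : D.Nonempty := closure_nonempty_iff.1 ⟨0, hD ⟨by simp, V.zero_mem⟩⟩
  obtain ⟨d, rfl⟩ := hDc.exists_eq_range hDne
  refine ⟨d, fun j => by simpa using (hDV ⟨j, rfl⟩).1, ?_⟩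
  have hXV : ∀ i, ∀ᵐ ω ∂μ, X i ω ∈ V := fun i => (htX i).mono fun ω hω =>
    Submodule.le_topologicalClosure _ (Submodule.subset_span (Set.mem_iUnion.2 ⟨i, hω⟩))
  have hproj : ∀ w : H, ∀ x ∈ V, inner ℝ (V.starProjection w) x = inner ℝ w x := fun w x hx => by
    rw [Submodule.inner_starProjection_left_eq_right, Submodule.starProjection_eq_self_iff.2 hx]
  filter_upwards [ae_all_iff.2 hXV] with ω hω w hw u hu
  have heq : lossDeviation ℓ X Y μ (V.starProjection w) ω = lossDeviation ℓ X Y μ w ω := by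
    unfold lossDeviation
    congr 1
    · simp only [hproj w _ (hω _)]
    · exact integral_congr_ae ((hXV 0).mono fun ω' h => by simp only [hproj w _ h])
  rw [← heq] at hu
  have hmem : V.starProjection w ∈ closure (Set.range d) :=
    hD ⟨by simpa using (V.norm_starProjection_apply_le w).trans hw,
      V.starProjection_apply_mem w⟩
  obtain ⟨_, hv, j, rfl⟩ := mem_closure_iff.1 hmem _
    (isOpen_Ioi.preimage (continuous_lossDeviation hℓ (hX 0) hXi hY ω)) hu
  exact ⟨j, hv⟩

/-- The tail bound for the deviation over the unit ball. -/
theorem measure_exists_lossDeviation_gt_le [CompleteSpace H] [MeasurableSpace H] [BorelSpace H]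
    [IsProbabilityMeasure μ] {φ : ℝ → ℝ} (hφ : IsOrliczNFunction φ) (hφ_one : orliczInv φ 1 = 1)
    (hℓ : LipschitzWith 1 ℓ) (hℓ0 : ℓ 0 = 0) {n : ℕ} [NeZero n] {X : Fin n → Ω → H}
    {Y : Fin n → Ω → ℝ} (hX : ∀ i, AEStronglyMeasurable (X i) μ)
    (h_indep : iIndepFun (fun i ω => (X i ω, Y i ω)) μ)
    (h_ident : ∀ i, IdentDistrib (fun ω => (X i ω, Y i ω)) (fun ω => (X 0 ω, Y 0 ω)) μ μ)
    {t a b : ℝ} (ha : 0 ≤ a) (hb : 0 ≤ b)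
    (hXa : momentNorm φ (fun ω => ‖X 0 ω‖) μ ≤ ENNReal.ofReal a)
    (hYb : momentNorm φ (Y 0) μ ≤ ENNReal.ofReal b) (ht : 1 ≤ t) (htn : t ≤ n) :
    μ {ω | ∃ w : H, ‖w‖ ≤ 1 ∧ 12 / √n * (a + b) * (1 + Real.exp 1 * √t) <
      lossDeviation ℓ X Y μ w ω} ≤ ENNReal.ofReal (Real.exp (-t)) := by
  have hYm : AEMeasurable (Y 0) μ := measurable_snd.comp_aemeasurable (h_ident 0).aemeasurable_fst
  have hXi := integrable_of_momentNorm_ne_top hφ hφ_one (hX 0).norm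
    (ne_top_of_le_ne_top ENNReal.ofReal_ne_top hXa)
  have hYi := integrable_of_momentNorm_ne_top hφ hφ_one hYm.aestronglyMeasurable
    (ne_top_of_le_ne_top ENNReal.ofReal_ne_top hYb)
  obtain ⟨d, hd1, hd⟩ := exists_seq_lossDeviation_dense hℓ hX hXi hYi
  -- Enlarging `a` and `b` by `1 / (k + 1)` makes them positive, as the finite bound requires, and
  -- the thresholds decrease to the desired one. The events `E k` therefore increase, and the strict
  -- inequality in the limiting event leaves room for some `u k`.
  set u : ℕ → ℝ := fun k =>
    12 / √n * ((a + 1 / ((k : ℝ) + 1)) + (b + 1 / ((k : ℝ) + 1))) * (1 + Real.exp 1 * √t) with hu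
  have hu_anti : Antitone u := by
    intro k m hkm
    have := Nat.one_div_le_one_div (α := ℝ) hkm
    simp only [hu]
    gcongr
  have hu_lim : Tendsto u atTop (𝓝 (12 / √n * (a + b) * (1 + Real.exp 1 * √t))) := by
    have h := tendsto_one_div_add_atTop_nhds_zero_nat (𝕜 := ℝ)
    simpa [hu] using (((h.const_add a).add (h.const_add b)).const_mul (12 / √n)).mul_const
      (1 + Real.exp 1 * √t)
  classical
  set E : ℕ → Set Ω := fun k =>
    {ω | ∃ w ∈ (Finset.range (k + 1)).image d, u k ≤ lossDeviation ℓ X Y μ w ω} with hE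
  have hE_mono : Monotone E := by
    rintro k m hkm ω ⟨w, hw, hdev⟩
    refine ⟨w, Finset.image_subset_image ?_ hw, (hu_anti hkm).trans hdev⟩
    exact Finset.range_subset_range.2 (by omega)
  have hE_le : ∀ k, μ (E k) ≤ ENNReal.ofReal (Real.exp (-t)) := by
    intro k
    have hk : 0 < 1 / ((k : ℝ) + 1) := Nat.one_div_pos_of_nat
    refine measure_exists_mem_finset_deviation_ge_le μ hφ hφ_one hℓ hℓ0 h_indep h_ident
      (integrable_lipschitz_inner_sub hℓ (hX 0) hXi hYi) (by positivity) (by positivity)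
      (hXa.trans (ENNReal.ofReal_le_ofReal (by linarith)))
      (hYb.trans (ENNReal.ofReal_le_ofReal (by linarith))) ht htn _ (by simp) fun w hw => ?_
    obtain ⟨j, -, rfl⟩ := Finset.mem_image.1 hw
    exact hd1 j
  calc μ _ ≤ μ (⋃ k, E k) := by
        refine measure_mono_ae ?_
        filter_upwards [hd] with ω hω
        rintro ⟨w, hw, hdev⟩
        obtain ⟨j, hj⟩ := hω w hw _ hdev
        obtain ⟨k, hk, hjk⟩ := ((hu_lim.eventually_lt_const hj).and (eventually_ge_atTop j)).exists
        exact Set.mem_iUnion.2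
          ⟨k, d j, Finset.mem_image_of_mem d (Finset.mem_range.2 (by omega)), hk.le⟩
    _ = ⨆ k, μ (E k) := hE_mono.measure_iUnion
    _ ≤ _ := iSup_le hE_le

end Reduction

/-! ### Normalization of the radius and the loss -/

theorem mainTheorem8
    {Ω : Type*} [MeasurableSpace Ω] (μ : Measure Ω) [IsProbabilityMeasure μ]
    {H : Type*} [NormedAddCommGroup H] [InnerProductSpace ℝ H] [CompleteSpace H]
    [MeasurableSpace H] [BorelSpace H]
    (φ : ℝ → ℝ) (hφ : IsOrliczNFunction φ) (hφ_one : orliczInv φ 1 = 1)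
    (ℓ : ℝ → ℝ) (hℓ : LipschitzWith 1 ℓ) (L : ℝ) (hL : 0 ≤ L)
    (n : ℕ) [NeZero n] (X : Fin n → Ω → H) (Y : Fin n → Ω → ℝ)
    (hX : ∀ i, AEStronglyMeasurable (X i) μ)
    (h_indep : iIndepFun (fun i ω => (X i ω, Y i ω)) μ)
    (h_ident : ∀ i, IdentDistrib (fun ω => (X i ω, Y i ω)) (fun ω => (X 0 ω, Y 0 ω)) μ μ)
    (δ : ℝ) (hδ : 0 < δ) (hδ_one : 1 ≤ Real.log (1 / δ)) (hδ_n : Real.log (1 / δ) ≤ n) :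
    (momentNorm φ (fun ω => ‖X 0 ω‖) μ ≠ ∞ → momentNorm φ (Y 0) μ ≠ ∞ →
      ∀ g ∈ linearLossClass H ℓ L, Integrable (fun ω => g (X 0 ω, Y 0 ω)) μ) ∧
    μ {ω |
        ((ENNReal.ofReal (12 / √n) *
            (ENNReal.ofReal L * momentNorm φ (fun ω' => ‖X 0 ω'‖) μ + momentNorm φ (Y 0) μ) *
            ENNReal.ofReal (1 + Real.exp 1 * √(Real.log (1 / δ))) : ℝ≥0∞) : EReal)
          < uniformDeviation (linearLossClass H ℓ L) (fun i ω' => (X i ω', Y i ω')) μ ω}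
      ≤ ENNReal.ofReal δ := by
  have hYm : AEMeasurable (Y 0) μ := measurable_snd.comp_aemeasurable (h_ident 0).aemeasurable_fst
  refine ⟨?_, ?_⟩
  · rintro hA hB _ ⟨w, -, rfl⟩
    exact integrable_lipschitz_inner_sub hℓ (hX 0)
      (integrable_of_momentNorm_ne_top hφ hφ_one (hX 0).norm hA)
      (integrable_of_momentNorm_ne_top hφ hφ_one hYm.aestronglyMeasurable hB) w
  have hn : (0 : ℝ) < n := by exact_mod_cast Nat.pos_of_ne_zero (NeZero.ne n)
  set t := Real.log (1 / δ) with ht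
  have hδt : Real.exp (-t) = δ := by
    rw [ht, one_div, Real.log_inv, neg_neg, Real.exp_log hδ]
  set A := ENNReal.ofReal L * momentNorm φ (fun ω' => ‖X 0 ω'‖) μ with hA
  set B := momentNorm φ (Y 0) μ with hB
  have hfac : 0 < 1 + Real.exp 1 * √t := by positivity
  -- Both outer factors are positive, so here the threshold is infinite and the event is empty.
  by_cases hfin : A + B = ∞
  · have hset : ENNReal.ofReal (12 / √n) * (A + B) * ENNReal.ofReal (1 + Real.exp 1 * √t) = ∞ := by
      rw [hfin, ENNReal.mul_top (ENNReal.ofReal_pos.2 (by positivity)).ne',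
        ENNReal.top_mul (ENNReal.ofReal_pos.2 hfac).ne']
    simp [hset]
  obtain ⟨hAfin, hBfin⟩ := ENNReal.add_ne_top.1 hfin
  -- The radius moves from the weights to the data. For `L = 0` this makes `X'` vanish, in agreement
  -- with `0 * ∞ = 0` in `A`, even if the norm of `X` is infinite.
  set X' : Fin n → Ω → H := fun i ω => L • X i ω with hX'
  have hscale : Measurable fun z : H × ℝ => (L • z.1, z.2) :=
    ((continuous_const_smul L).measurable.comp measurable_fst).prodMk measurable_snd
  have hX'm : ∀ i, AEStronglyMeasurable (X' i) μ := fun i => (hX i).const_smul L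
  have hnorm : momentNorm φ (fun ω => ‖X' 0 ω‖) μ = A := by
    simp only [hX', norm_smul, Real.norm_of_nonneg hL]
    exact momentNorm_const_mul L hL φ _ μ
  -- Contraction needs a loss vanishing at `0`; subtracting a constant does not change the
  -- deviation.
  set ℓ' : ℝ → ℝ := fun s => ℓ s - ℓ 0 with hℓ'def
  have hℓ' : LipschitzWith 1 ℓ' := LipschitzWith.of_dist_le_mul fun s s' => by
    rw [hℓ'def, dist_sub_right]; exact hℓ.dist_le_mul s s'
  have hXi := integrable_of_momentNorm_ne_top hφ hφ_one (hX'm 0).norm (hnorm ▸ hAfin)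
  have hYi := integrable_of_momentNorm_ne_top hφ hφ_one hYm.aestronglyMeasurable hBfin
  have hmain := measure_exists_lossDeviation_gt_le hφ hφ_one hℓ' (by simp [hℓ'def]) hX'm
    (h_indep.comp (fun _ z => (L • z.1, z.2)) fun _ => hscale) (fun i => (h_ident i).comp hscale)
    ENNReal.toReal_nonneg ENNReal.toReal_nonneg
    (by rw [hnorm, ENNReal.ofReal_toReal hAfin]) (by rw [ENNReal.ofReal_toReal hBfin]) hδ_one hδ_n
  rw [hδt] at hmain
  refine (measure_mono ?_).trans hmain
  intro ω hω
  simp only [Set.mem_ofPred_eq, uniformDeviation, lt_iSup_iff] at hω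
  obtain ⟨_, ⟨w, hw, rfl⟩, hlt⟩ := hω
  have hrhs : ENNReal.ofReal (12 / √n) * (A + B) * ENNReal.ofReal (1 + Real.exp 1 * √t) =
      ENNReal.ofReal (12 / √n * (A.toReal + B.toReal) * (1 + Real.exp 1 * √t)) := by
    rw [ENNReal.ofReal_mul (by positivity), ENNReal.ofReal_mul (by positivity),
      ENNReal.ofReal_add ENNReal.toReal_nonneg ENNReal.toReal_nonneg,
      ENNReal.ofReal_toReal hAfin, ENNReal.ofReal_toReal hBfin]
  rw [hrhs, EReal.coe_ennreal_ofReal, max_eq_left (by positivity), EReal.coe_lt_coe_iff] at hlt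
  have hinner : ∀ x : H, inner ℝ (L⁻¹ • w) (L • x) = inner ℝ w x := by
    intro x
    rcases eq_or_ne L 0 with h0 | h0
    · have : w = 0 := norm_le_zero_iff.1 (h0 ▸ hw)
      simp [this]
    · rw [inner_smul_left, inner_smul_right]
      simp [h0]
  refine ⟨L⁻¹ • w, ?_, hlt.trans_eq ?_⟩
  · rw [norm_smul, norm_inv, Real.norm_of_nonneg hL]
    exact inv_mul_le_one_of_le₀ hw hL
  -- Integrability is taken from the scaled data, since `X` itself need not have finite norm when `L
  -- = 0`.
  · have hi : Integrable (fun ω' => ℓ (inner ℝ w (X 0 ω') - Y 0 ω')) μ := by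
      simpa only [hX', hinner] using integrable_lipschitz_inner_sub hℓ (hX'm 0) hXi hYi (L⁻¹ • w)
    simp only [lossDeviation, hX', hinner, hℓ'def]
    rw [integral_sub hi (integrable_const _), Finset.sum_sub_distrib]
    simp only [Finset.sum_const, Finset.card_univ, Fintype.card_fin, nsmul_eq_mul, integral_const,
      probReal_univ, one_smul]
    field_simp
    ring
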